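/- Let $0 \le h < 1/\sqrt2$, and let $d = d(n)$ be at least polylogarithmic in $n$ with exponent larger than one: there are $a > 1$ and $C > 0$ with $d(n) \ge C(\log n)^a$ for all sufficiently large $n$. For each $n$ consider random matrices $\Lambda, \Omega \in \mathbb{R}^{n\times n}$ generated as follows. All entries of $\Lambda$ are zero except $\Lambda_{i,i+1}$, $1 \le i \le n-1$, which are independent and uniformly distributed on $[-h,h]$ (for $h=0$: equal to $0$ almost surely). $\Omega_{i,j} = \langle v_i, v_j\rangle$, where $v_1$ is uniform on the unit sphere of $\mathbb{R}^{d}$ and, for $i \ge 2$, conditionally on $v_1,\dots,v_{i-1}$, the vector $v_i$ is uniform on the unit sphere of the hyperplane orthogonal to $v_{i-1}$. (The joint law of $\Lambda$ and $(v_i)_i$ may be arbitrary; in particular they may be independent.) Put $\Sigma = (I-\Lambda)^{-T}\,\Omega\,(I-\Lambda)^{-1}$. Then there are real sequences $\zeta_h(n)$, $\chi_h(n)$, $\delta_{1,n}$, $\delta_{2,n}$, depending only on $h$, the function $d$ and $n$, such that $0 \le \zeta_h(n) \le h + o(1)$; if $h > 0$, then $\chi_h(n) \ge c\,n^{-2}$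 for some $c > 0$ and all large $n$; $\delta_{1,n} \to 0$ and $\delta_{2,n}\to 0$ as $n \to \infty$; and for every sufficiently large $n$ we have $0 \le \delta_{1,n}, \delta_{2,n} < \tfrac12$, $$\mathbb{P}\Big[\forall i:\ |\Sigma_{i-1,i}|,\ |\Sigma_{i,i+1}|,\ |\Sigma_{i-1,i+1}| \le \zeta_h(n)\, \Sigma_{i,i}\Big] \ge 1-\delta_{1,n}$$ and $$\mathbb{P}\Big[\forall\, 1 \le i \le n-1:\ |\Lambda_{i,i+1}| \ge \chi_h(n)\Big] \ge 1-\delta_{2,n}.$$ In the first event $i$ ranges over $\{1,\dots,n\}$, and for each $i$ only those of the three inequalities are required whose indices lie in $\{1,\dots,n\}$. -/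

import Mathlib

open MeasureTheory ProbabilityTheory Filter Topology

noncomputable section

/-- The uniform distribution on the interval `[-h, h]`; for `h = 0` it is the point mass at `0`. -/
def uniformSymm (h : ℝ) : Measure ℝ :=
  if h = 0 then Measure.dirac 0 else volume[|Set.Icc (-h) h]

/-- The uniform distribution on the unit sphere of a linear subspace `W` of `ℝ^d`: the surface
measure of the unit sphere of `W`, normalised to total mass one, viewed as a measure on `ℝ^d`. -/
def unitSphereUniform {d : ℕ} (W : Submodule ℝ (EuclideanSpace ℝ (Fin d))) :
    Measure (EuclideanSpace ℝ (Fin d)) :=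
  (((volume : Measure W).toSphere Set.univ)⁻¹ • (volume : Measure W).toSphere).map
    (fun x : Metric.sphere (0 : W) 1 => ((x : W) : EuclideanSpace ℝ (Fin d)))

/-- `Λ` is a random weight matrix of the directed path on `n` vertices: the only entries that are
not zero are `Λ i (i + 1)`, and these are independent and uniformly distributed on `[-h, h]`. -/
structure IsRandomPathWeights {S : Type*} [MeasurableSpace S] (P : Measure S) {n : ℕ} (h : ℝ)
    (Λ : S → Matrix (Fin n) (Fin n) ℝ) : Prop where
  zero : ∀ (s : S) (i j : Fin n), (i : ℕ) + 1 ≠ j → Λ s i j = 0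
  law : ∀ i j : Fin n, (i : ℕ) + 1 = j → HasLaw (fun s => Λ s i j) (uniformSymm h) P
  indep : iIndepFun
    (fun (e : {e : Fin n × Fin n // (e.1 : ℕ) + 1 = e.2}) (s : S) => Λ s e.1.1 e.1.2) P

/-- `v` is a random sequence of `n` unit vectors of `ℝ^d`: the first one is uniform on the unit
sphere, and the conditional distribution of each further one, given all the previous ones, is
uniform on the unit sphere of the subspace orthogonal to its immediate predecessor. -/
structure IsRandomUnitVectors {S : Type*} [MeasurableSpace S] (P : Measure S) {n d : ℕ}
    (v : Fin n → S → EuclideanSpace ℝ (Fin d)) : Prop where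
  first : ∀ i : Fin n, (i : ℕ) = 0 → HasLaw (v i) (unitSphereUniform ⊤) P
  next : ∀ i j : Fin n, (i : ℕ) + 1 = j →
    ∃ κ : Kernel ({k : Fin n // k < j} → EuclideanSpace ℝ (Fin d)) (EuclideanSpace ℝ (Fin d)),
      IsMarkovKernel κ ∧
      HasCondDistrib (v j) (fun s (k : {k : Fin n // k < j}) => v k s) κ P ∧
      ∀ᵐ s ∂P, κ (fun k => v k s) =
        unitSphereUniform (Submodule.span ℝ {v i s})ᗮ

/-- The data covariance matrix `Σ = (I - Λ)⁻ᵀ Ω (I - Λ)⁻¹` of a linear structural equation model. -/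
def dataCovariance {n : ℕ} (Λ Ω : Matrix (Fin n) (Fin n) ℝ) : Matrix (Fin n) (Fin n) ℝ :=
  ((1 - Λ)⁻¹).transpose * Ω * (1 - Λ)⁻¹

/-- For every `i`, each of `|M (i-1) i|`, `|M i (i+1)|`, `|M (i-1) (i+1)|` whose indices lie in the
range is at most `ζ * M i i`. -/
def LocallyDominated {n : ℕ} (ζ : ℝ) (M : Matrix (Fin n) (Fin n) ℝ) : Prop :=
  ∀ i : Fin n,
    (∀ j : Fin n, (j : ℕ) + 1 = i → |M j i| ≤ ζ * M i i) ∧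
    (∀ k : Fin n, (i : ℕ) + 1 = k → |M i k| ≤ ζ * M i i) ∧
    (∀ j k : Fin n, (j : ℕ) + 1 = i → (i : ℕ) + 1 = k → |M j k| ≤ ζ * M i i)

end

/-! `Σ` is the Gram matrix of vectors `w j = v j + Λ i j • w i`, with `i` the predecessor of `j`. If
the `v i` were exactly orthonormal, then `‖w j‖² = 1 + l² A` and `⟨w i, w j⟩ = l A`, with `l = Λ i
j` and `A = ‖w i‖² ≤ 1 / (1 - h²)`. Domination by `h` then reads `|l| (1 - h |l|) A ≤ h`. It holds
because `t (1 - h t)` increases on `[0, h]` when `h² ≤ 1 / 2` and equals `h (1 - h²)` at `t = h`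
(`abs_mul_le_of_sq_le_half`).

Near orthogonality suffices: `locallyDominated_of_abs_inner_le` propagates errors of size `σ`
deterministically, given only `|Λ i j| ≤ h`. Spherical concentration with a union bound over pairs
makes `σ = o(1)` possible once `d` outgrows `log n` (`eventually_sq_mul_exp_le`). The lower bound on
the weights is a separate union bound over edges. -/

/-! ### Concentration of measure on spheres. -/

/-- A cone over a spherical cap lies in a ball of smaller radius. -/
lemma smul_cap_subset_closedBall {E : Type*} [NormedAddCommGroup E] [InnerProductSpace ℝ E]
    {u : E} (hu : ‖u‖ ≤ 1) {τ : ℝ} (hτ : 0 ≤ τ) (hτ' : τ ^ 2 ≤ 1 / 2) {r : ℝ} (hr : 0 ≤ r)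
    (hr' : r ≤ 1) {y : E} (hy : ‖y‖ = 1) (huy : τ ≤ inner ℝ u y) :
    r • y ∈ Metric.closedBall (τ • u) (√(1 - τ ^ 2)) := by
  rw [mem_closedBall_iff_norm]
  apply Real.le_sqrt_of_sq_le
  rw [norm_sub_sq_real, norm_smul, norm_smul, inner_smul_left, inner_smul_right, hy,
    real_inner_comm, Real.norm_eq_abs, Real.norm_eq_abs, mul_pow, mul_pow, sq_abs, sq_abs]
  have h1 : ‖u‖ ^ 2 ≤ 1 := by nlinarith [norm_nonneg u]
  have h2 : r * τ * τ ≤ r * τ * inner ℝ u y := by gcongr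
  have h3 : τ ^ 2 * ‖u‖ ^ 2 ≤ τ ^ 2 := by nlinarith [sq_nonneg τ]
  simp only [conj_trivial]
  -- What remains is `(1 - r) * (1 + r - 2 * τ ^ 2) ≥ 0`.
  nlinarith [mul_nonneg (sub_nonneg.2 hr') hr, mul_nonneg (sub_nonneg.2 hr') (sub_nonneg.2 hτ')]

lemma sqrt_one_sub_sq_le_exp (τ : ℝ) : √(1 - τ ^ 2) ≤ Real.exp (-(τ ^ 2 / 2)) := by
  rw [Real.sqrt_le_left (Real.exp_pos _).le, ← Real.exp_nat_mul]
  have := Real.add_one_le_exp (-τ ^ 2)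
  calc 1 - τ ^ 2 ≤ Real.exp (-τ ^ 2) := by linarith
    _ = _ := by congr 1; push_cast; ring

section Sphere

variable {E : Type*} [NormedAddCommGroup E] [InnerProductSpace ℝ E] [FiniteDimensional ℝ E]
  [MeasurableSpace E] [BorelSpace E]

/-- Concentration of the surface measure of the sphere: the measure of a one-sided cap. -/
lemma toSphere_cap_le (μ : Measure E) [μ.IsAddHaarMeasure]
    {u : E} (hu : ‖u‖ ≤ 1) {τ : ℝ} (hτ : 0 ≤ τ) (hτ' : τ ^ 2 ≤ 1 / 2) :
    μ.toSphere {y | τ ≤ inner ℝ u (y : E)} ≤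
      ENNReal.ofReal (Real.exp (-(τ ^ 2 / 2)) ^ Module.finrank ℝ E) * μ.toSphere Set.univ := by
  have hm : MeasurableSet {y : Metric.sphere (0 : E) 1 | τ ≤ inner ℝ u (y : E)} :=
    (isClosed_le continuous_const (by fun_prop)).measurableSet
  -- Surface measure is the dimension times the volume of the cone, so a ball containing the cone
  -- bounds the cap.
  rw [Measure.toSphere_apply' _ hm, Measure.toSphere_apply_univ, mul_left_comm]
  gcongr
  calc _ ≤ μ (Metric.closedBall (τ • u) (√(1 - τ ^ 2))) := by
        apply measure_mono
        rintro _ ⟨r, hr, _, ⟨y, hy, rfl⟩, rfl⟩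
        exact smul_cap_subset_closedBall hu hτ hτ' hr.1.le hr.2.le (by simp) hy
    _ = ENNReal.ofReal (√(1 - τ ^ 2) ^ Module.finrank ℝ E) * μ (Metric.ball 0 1) :=
        Measure.addHaar_closedBall _ _ (Real.sqrt_nonneg _)
    _ ≤ _ := by
        gcongr
        exact sqrt_one_sub_sq_le_exp τ

/-- Concentration of the surface measure of the sphere: the measure of a two-sided cap. -/
lemma toSphere_abs_cap_le (μ : Measure E) [μ.IsAddHaarMeasure]
    {u : E} (hu : ‖u‖ ≤ 1) {τ : ℝ} (hτ : 0 ≤ τ) (hτ' : τ ^ 2 ≤ 1 / 2) :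
    μ.toSphere {y | τ ≤ |inner ℝ u (y : E)|} ≤
      2 * ENNReal.ofReal (Real.exp (-(τ ^ 2 / 2)) ^ Module.finrank ℝ E) *
        μ.toSphere Set.univ := by
  have hsub : {y : Metric.sphere (0 : E) 1 | τ ≤ |inner ℝ u (y : E)|} ⊆
      {y | τ ≤ inner ℝ u (y : E)} ∪ {y | τ ≤ inner ℝ (-u) (y : E)} := by
    intro y hy
    simpa [le_abs, inner_neg_left] using hy
  refine (measure_mono hsub).trans <| (measure_union_le _ _).trans ?_
  rw [mul_assoc, two_mul]
  exact add_le_add (toSphere_cap_le μ hu hτ hτ') (toSphere_cap_le μ (by simpa using hu) hτ hτ')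

end Sphere

section UnitSphereUniform

variable {d : ℕ} (W : Submodule ℝ (EuclideanSpace ℝ (Fin d)))

lemma measurable_coe_sphere_submodule : Measurable
    (fun x : Metric.sphere (0 : W) 1 => ((x : W) : EuclideanSpace ℝ (Fin d))) :=
  (by fun_prop : Continuous _).measurable

lemma unitSphereUniform_norm_ne_one : unitSphereUniform W {x | ‖x‖ ≠ 1} = 0 := by
  have hm : MeasurableSet {x : EuclideanSpace ℝ (Fin d) | ‖x‖ ≠ 1} :=
    (measurableSet_eq_fun (by fun_prop) (by fun_prop)).compl
  rw [unitSphereUniform, Measure.map_apply (measurable_coe_sphere_submodule W) hm]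
  convert measure_empty (μ := (((volume : Measure W).toSphere Set.univ)⁻¹ •
    (volume : Measure W).toSphere))
  ext x
  have hx : ‖((x : W) : EuclideanSpace ℝ (Fin d))‖ = 1 := mem_sphere_zero_iff_norm.1 x.2
  simp only [Set.mem_preimage, Set.mem_empty_iff_false, iff_false]
  exact fun h => h hx

/-- Inner products with a fixed vector of the unit ball concentrate around zero under the uniform
distribution on the unit sphere of a subspace. -/
lemma unitSphereUniform_abs_inner_le (u : EuclideanSpace ℝ (Fin d)) (hu : ‖u‖ ≤ 1) {τ : ℝ}
    (hτ : 0 ≤ τ) (hτ' : τ ^ 2 ≤ 1 / 2) {m : ℕ} (hm : m ≤ Module.finrank ℝ W) :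
    unitSphereUniform W {x | τ ≤ |inner ℝ u x|} ≤
      ENNReal.ofReal (2 * Real.exp (-(τ ^ 2 / 2)) ^ m) := by
  have hms : MeasurableSet {x : EuclideanSpace ℝ (Fin d) | τ ≤ |inner ℝ u x|} :=
    (isClosed_le continuous_const (by fun_prop)).measurableSet
  rw [unitSphereUniform, Measure.map_apply (measurable_coe_sphere_submodule W) hms,
    Measure.smul_apply, smul_eq_mul]
  have heq : (fun x : Metric.sphere (0 : W) 1 => ((x : W) : EuclideanSpace ℝ (Fin d))) ⁻¹'
      {x | τ ≤ |inner ℝ u x|} = {y : Metric.sphere (0 : W) 1 | τ ≤ |inner ℝ (W.orthogonalProjectionOnto u) (y : W)|} := by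
    ext y
    change τ ≤ _ ↔ τ ≤ _
    simp
  have hu' : ‖W.orthogonalProjectionOnto u‖ ≤ 1 :=
    (W.norm_orthogonalProjectionOnto_apply_le u).trans hu
  rw [heq]
  calc _ ≤ ((volume : Measure W).toSphere Set.univ)⁻¹ *
        (2 * ENNReal.ofReal (Real.exp (-(τ ^ 2 / 2)) ^ Module.finrank ℝ W) *
        (volume : Measure W).toSphere Set.univ) := by
        gcongr
        exact toSphere_abs_cap_le _ hu' hτ hτ'
    _ = 2 * ENNReal.ofReal (Real.exp (-(τ ^ 2 / 2)) ^ Module.finrank ℝ W) *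
        (((volume : Measure W).toSphere Set.univ)⁻¹ *
          (volume : Measure W).toSphere Set.univ) := by ring
    _ ≤ 2 * ENNReal.ofReal (Real.exp (-(τ ^ 2 / 2)) ^ Module.finrank ℝ W) * 1 := by
        gcongr
        -- An inequality, since the total mass is zero when `W` is trivial.
        exact ENNReal.inv_mul_le_one _
    _ = ENNReal.ofReal (2 * Real.exp (-(τ ^ 2 / 2)) ^ Module.finrank ℝ W) := by
        rw [ENNReal.ofReal_mul zero_le_two, mul_one]; simp
    _ ≤ _ := by
        apply ENNReal.ofReal_le_ofReal
        gcongr 2 * ?_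
        exact pow_le_pow_of_le_one (Real.exp_pos _).le
          (Real.exp_le_one_iff.2 (by nlinarith [sq_nonneg τ])) hm

end UnitSphereUniform

lemma sub_one_le_finrank_orthogonal_span_singleton {d : ℕ} (x : EuclideanSpace ℝ (Fin d)) :
    d - 1 ≤ Module.finrank ℝ (Submodule.span ℝ {x})ᗮ := by
  have h1 := (Submodule.span ℝ {x}).finrank_add_finrank_orthogonal
  have h2 : Module.finrank ℝ (Submodule.span ℝ {x}) ≤ 1 := by
    simpa using finrank_span_le_card (R := ℝ) ({x} : Set (EuclideanSpace ℝ (Fin d)))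
  rw [finrank_euclideanSpace_fin] at h1
  omega

/-! ### Near orthogonality of the random vectors. -/

/-- A bound on the conditional probability of an event bounds its probability. -/
lemma measure_le_of_hasCondDistrib {S 𝓧 𝓨 : Type*} [MeasurableSpace S] [MeasurableSpace 𝓧]
    [MeasurableSpace 𝓨] {P : Measure S} [IsProbabilityMeasure P] {X : S → 𝓧} {Y : S → 𝓨}
    {κ : Kernel 𝓧 𝓨} [IsMarkovKernel κ] (hXY : HasCondDistrib Y X κ P) {B : Set (𝓧 × 𝓨)}
    (hB : MeasurableSet B) {c : ENNReal}
    (hc : ∀ᵐ s ∂P, κ (X s) (Prod.mk (X s) ⁻¹' B) ≤ c) :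
    P {s | (X s, Y s) ∈ B} ≤ c := by
  have hX : AEMeasurable X P := hXY.aemeasurable_fst
  have : IsProbabilityMeasure (P.map X) := Measure.isProbabilityMeasure_map hX
  calc P {s | (X s, Y s) ∈ B} = ((P.map X) ⊗ₘ κ) B := HasLaw.measure_eq hXY (p := (· ∈ B)) hB
    _ = ∫⁻ x, κ x (Prod.mk x ⁻¹' B) ∂(P.map X) := Measure.compProd_apply hB
    _ = ∫⁻ s, κ (X s) (Prod.mk (X s) ⁻¹' B) ∂P :=
        lintegral_map' (Kernel.measurable_kernel_prodMk_left hB).aemeasurable hX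
    _ ≤ ∫⁻ _, c ∂P := lintegral_mono_ae hc
    _ = c := by simp

section RandomUnitVectors

variable {S : Type*} [MeasurableSpace S] {P : Measure S} [IsProbabilityMeasure P] {n d : ℕ}
  {v : Fin n → S → EuclideanSpace ℝ (Fin d)}

lemma IsRandomUnitVectors.ae_norm_eq_one (hv : IsRandomUnitVectors P v) (j : Fin n) :
    ∀ᵐ s ∂P, ‖v j s‖ = 1 := by
  have hm : MeasurableSet {x : EuclideanSpace ℝ (Fin d) | ‖x‖ ≠ 1} :=
    (measurableSet_eq_fun (by fun_prop) (by fun_prop)).compl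
  rw [ae_iff]
  by_cases hj : (j : ℕ) = 0
  · exact ((hv.first j hj).measure_eq hm).trans (unitSphereUniform_norm_ne_one _)
  · obtain ⟨κ, _, hκ, hκ'⟩ := hv.next ⟨j - 1, by omega⟩ j (by simp; omega)
    refine le_antisymm (measure_le_of_hasCondDistrib hκ (measurable_snd hm) ?_) zero_le
    filter_upwards [hκ'] with s hs
    rw [hs]
    exact (unitSphereUniform_norm_ne_one _).le

/-- Given the whole past of `j`, the vector `v i` is fixed and the cap bound is uniform in its
direction, so `i` need not be adjacent to `j`. -/
lemma IsRandomUnitVectors.measure_abs_inner_le_of_lt (hv : IsRandomUnitVectors P v) {τ : ℝ}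
    (hτ : 0 ≤ τ) (hτ' : τ ^ 2 ≤ 1 / 2) {i j : Fin n} (hij : i < j) :
    P {s | τ ≤ |inner ℝ (v i s) (v j s)|} ≤
      ENNReal.ofReal (2 * Real.exp (-(τ ^ 2 / 2)) ^ (d - 1)) := by
  obtain ⟨κ, _, hκ, hκ'⟩ := hv.next ⟨j - 1, by omega⟩ j (by
    have : (i : ℕ) < j := hij
    simp; omega)
  let B : Set (({k : Fin n // k < j} → EuclideanSpace ℝ (Fin d)) × EuclideanSpace ℝ (Fin d)) :=
    {p | τ ≤ |inner ℝ (p.1 ⟨i, hij⟩) p.2|}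
  have hB : MeasurableSet B := measurableSet_le measurable_const (by fun_prop)
  refine measure_le_of_hasCondDistrib hκ hB ?_
  filter_upwards [hκ', hv.ae_norm_eq_one i] with s hs hi
  rw [hs]
  exact unitSphereUniform_abs_inner_le _ (v i s) hi.le hτ hτ'
    (sub_one_le_finrank_orthogonal_span_singleton _)

lemma IsRandomUnitVectors.measure_abs_inner_le (hv : IsRandomUnitVectors P v) {τ : ℝ}
    (hτ : 0 ≤ τ) (hτ' : τ ^ 2 ≤ 1 / 2) {i j : Fin n} (hij : i ≠ j) :
    P {s | τ ≤ |inner ℝ (v i s) (v j s)|} ≤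
      ENNReal.ofReal (2 * Real.exp (-(τ ^ 2 / 2)) ^ (d - 1)) := by
  rcases hij.lt_or_gt with h | h
  · exact hv.measure_abs_inner_le_of_lt hτ hτ' h
  · simp_rw [real_inner_comm (v j _) (v i _)]
    exact hv.measure_abs_inner_le_of_lt hτ hτ' h

/-- All pairs of distinct vectors are almost orthogonal, outside a set of small measure. -/
lemma IsRandomUnitVectors.measure_exists_abs_inner_le (hv : IsRandomUnitVectors P v) {τ : ℝ}
    (hτ : 0 ≤ τ) (hτ' : τ ^ 2 ≤ 1 / 2) :
    P {s | ∃ i j, i ≠ j ∧ τ ≤ |inner ℝ (v i s) (v j s)|} ≤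
      ENNReal.ofReal (n ^ 2 * (2 * Real.exp (-(τ ^ 2 / 2)) ^ (d - 1))) := by
  have hsub : {s | ∃ i j, i ≠ j ∧ τ ≤ |inner ℝ (v i s) (v j s)|} =
      ⋃ p : Fin n × Fin n, {s | p.1 ≠ p.2 ∧ τ ≤ |inner ℝ (v p.1 s) (v p.2 s)|} := by
    ext s; simp
  rw [hsub]
  refine (measure_iUnion_fintype_le _ _).trans ?_
  calc _ ≤ ∑ _p : Fin n × Fin n, ENNReal.ofReal (2 * Real.exp (-(τ ^ 2 / 2)) ^ (d - 1)) := by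
        refine Finset.sum_le_sum fun p _ => ?_
        by_cases hp : p.1 = p.2
        · simp [hp]
        · exact (measure_mono fun s hs => hs.2).trans (hv.measure_abs_inner_le hτ hτ' hp)
    _ = _ := by
        rw [ENNReal.ofReal_mul (p := (n : ℝ) ^ 2) (by positivity)]
        simp [sq]

end RandomUnitVectors

/-! ### Bounds on the random edge weights. -/

section RandomPathWeights

variable {S : Type*} [MeasurableSpace S] {P : Measure S} {n : ℕ} {h : ℝ}
  {Λ : S → Matrix (Fin n) (Fin n) ℝ}

lemma IsRandomPathWeights.ae_abs_le (hΛ : IsRandomPathWeights P h Λ) (hh : 0 ≤ h)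
    (i j : Fin n) : ∀ᵐ s ∂P, |Λ s i j| ≤ h := by
  by_cases hij : (i : ℕ) + 1 = j
  · refine ((hΛ.law i j hij).ae_iff (p := fun x => |x| ≤ h)
      (measurableSet_setOfPred.1 (measurableSet_le (by fun_prop) measurable_const))).2 ?_
    unfold uniformSymm
    split_ifs with h0
    · simp [h0]
    · filter_upwards [ae_cond_mem measurableSet_Icc] with x hx
      exact abs_le.2 hx
  · simp [hΛ.zero _ i j hij, hh]

lemma uniformSymm_abs_lt_le {h : ℝ} (hh : 0 < h) (t : ℝ) :
    uniformSymm h {x | |x| < t} ≤ ENNReal.ofReal (t / h) := by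
  rw [uniformSymm, if_neg hh.ne', cond_apply measurableSet_Icc, Real.volume_Icc]
  have hsub : Set.Icc (-h) h ∩ {x | |x| < t} ⊆ Set.Ioo (-t) t := fun x hx => abs_lt.1 hx.2
  calc _ ≤ (ENNReal.ofReal (h - -h))⁻¹ * ENNReal.ofReal (t - -t) := by
        gcongr
        exact (measure_mono hsub).trans_eq Real.volume_Ioo
    _ = ENNReal.ofReal (t / h) := by
        rw [← ENNReal.ofReal_inv_of_pos (by linarith), ← ENNReal.ofReal_mul (by
          rw [inv_nonneg]; linarith)]
        congr 1
        field_simp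

/-- With high probability no edge weight is smaller than a given threshold. -/
lemma IsRandomPathWeights.measure_exists_abs_lt_le (hΛ : IsRandomPathWeights P h Λ) (hh : 0 < h)
    (t : ℝ) :
    P {s | ∃ i j : Fin n, (i : ℕ) + 1 = j ∧ |Λ s i j| < t} ≤ ENNReal.ofReal (n * (t / h)) := by
  have hsub : {s | ∃ i j : Fin n, (i : ℕ) + 1 = j ∧ |Λ s i j| < t} ⊆
      ⋃ i : Fin n, {s | ∃ j : Fin n, (i : ℕ) + 1 = j ∧ |Λ s i j| < t} := by
    intro s hs; simpa using hs
  refine (measure_mono hsub).trans <| (measure_iUnion_fintype_le _ _).trans ?_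
  calc _ ≤ ∑ _i : Fin n, ENNReal.ofReal (t / h) := by
        refine Finset.sum_le_sum fun i _ => ?_
        by_cases hi : (i : ℕ) + 1 < n
        · have hlaw := hΛ.law i ⟨i + 1, hi⟩ rfl
          have hm : MeasurableSet {x : ℝ | |x| < t} :=
            measurableSet_lt (by fun_prop) measurable_const
          refine le_trans (measure_mono ?_) ((hlaw.measure_eq hm).trans_le
            (uniformSymm_abs_lt_le hh t))
          rintro s ⟨j, hj, hs⟩
          obtain rfl : (⟨i + 1, hi⟩ : Fin n) = j := Fin.ext hj
          exact hs
        · have : {s | ∃ j : Fin n, (i : ℕ) + 1 = j ∧ |Λ s i j| < t} = ∅ := by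
            ext s
            refine iff_of_false ?_ (Set.notMem_empty s)
            rintro ⟨j, hj, -⟩
            omega
          simp [this]
    _ = _ := by
        rw [ENNReal.ofReal_mul (by positivity)]
        simp

end RandomPathWeights

/-- A set whose complement is covered by a set of small measure has large measure; no
measurability is required. -/
lemma one_sub_le_measureReal {S : Type*} [MeasurableSpace S] {P : Measure S}
    [IsProbabilityMeasure P] {G B : Set S} {δ : ℝ} (hδ : 0 ≤ δ) (hB : P B ≤ ENNReal.ofReal δ)
    (hGB : ∀ᵐ s ∂P, s ∉ B → s ∈ G) : 1 - δ ≤ P.real G := by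
  have h1 : (1 : ENNReal) ≤ P (G ∪ B) := by
    rw [← measure_univ (μ := P)]
    apply measure_mono_ae
    filter_upwards [hGB] with s hs _
    by_cases hB : s ∈ B
    · exact Or.inr hB
    · exact Or.inl (hs hB)
  have h2 : (1 : ℝ) ≤ P.real (G ∪ B) := by
    simpa [Measure.real] using ENNReal.toReal_mono (measure_ne_top _ _) h1
  have h3 : P.real B ≤ δ := ENNReal.toReal_le_of_le_ofReal hδ hB
  linarith [measureReal_union_le (μ := P) G B]

/-! ### The covariance as a Gram matrix. -/

section PathInverse

variable {n : ℕ} {Λ : Matrix (Fin n) (Fin n) ℝ}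

lemma det_one_sub_eq_one (hΛ : ∀ i j : Fin n, (i : ℕ) + 1 ≠ j → Λ i j = 0) :
    (1 - Λ).det = 1 := by
  have htri : (1 - Λ).BlockTriangular id := by
    intro i j hij
    have hij' : (j : ℕ) < i := hij
    simp [Matrix.one_apply_ne (show i ≠ j by rintro rfl; exact lt_irrefl _ hij),
      hΛ i j (by omega)]
  rw [Matrix.det_of_isUpperTriangular htri]
  simp [fun i : Fin n => hΛ i i (by omega)]

lemma inv_one_sub_eq (hΛ : ∀ i j : Fin n, (i : ℕ) + 1 ≠ j → Λ i j = 0) :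
    (1 - Λ)⁻¹ = 1 + (1 - Λ)⁻¹ * Λ := by
  have hdet : IsUnit (1 - Λ).det := by simp [det_one_sub_eq_one hΛ]
  have := Matrix.nonsing_inv_mul _ hdet
  rw [Matrix.mul_sub, Matrix.mul_one, sub_eq_iff_eq_add] at this
  exact this

/-- The vectors whose Gram matrix is the covariance matrix of the model. -/
noncomputable def modelVectors {E : Type*} [AddCommGroup E] [Module ℝ E]
    (Λ : Matrix (Fin n) (Fin n) ℝ) (v : Fin n → E) (j : Fin n) : E :=
  ∑ k, (1 - Λ)⁻¹ k j • v k

lemma modelVectors_eq {E : Type*} [AddCommGroup E] [Module ℝ E]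
    (hΛ : ∀ i j : Fin n, (i : ℕ) + 1 ≠ j → Λ i j = 0) (v : Fin n → E) (j : Fin n) :
    modelVectors Λ v j = v j + ∑ i, Λ i j • modelVectors Λ v i := by
  conv_lhs => rw [modelVectors, inv_one_sub_eq hΛ]
  simp_rw [Matrix.add_apply, add_smul, Finset.sum_add_distrib]
  congr 1
  · simp [Matrix.one_apply]
  · simp_rw [modelVectors, Finset.smul_sum, Matrix.mul_apply, Finset.sum_smul, smul_smul]
    rw [Finset.sum_comm]
    simp_rw [mul_comm]

lemma modelVectors_zero {E : Type*} [AddCommGroup E] [Module ℝ E]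
    (hΛ : ∀ i j : Fin n, (i : ℕ) + 1 ≠ j → Λ i j = 0) (v : Fin n → E) {j : Fin n}
    (hj : (j : ℕ) = 0) : modelVectors Λ v j = v j := by
  rw [modelVectors_eq hΛ, Finset.sum_eq_zero, add_zero]
  intro i _
  rw [hΛ i j (by omega), zero_smul]

lemma modelVectors_succ {E : Type*} [AddCommGroup E] [Module ℝ E]
    (hΛ : ∀ i j : Fin n, (i : ℕ) + 1 ≠ j → Λ i j = 0) (v : Fin n → E) {i j : Fin n}
    (hij : (i : ℕ) + 1 = j) :
    modelVectors Λ v j = v j + Λ i j • modelVectors Λ v i := by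
  rw [modelVectors_eq hΛ, Finset.sum_eq_single i]
  · intro k _ hk
    rw [hΛ k j (fun h => hk (Fin.ext (by omega))), zero_smul]
  · simp

lemma dataCovariance_gram_apply {E : Type*} [NormedAddCommGroup E] [InnerProductSpace ℝ E]
    (Λ : Matrix (Fin n) (Fin n) ℝ) (v : Fin n → E) (i j : Fin n) :
    dataCovariance Λ (Matrix.gram ℝ v) i j =
      inner ℝ (modelVectors Λ v i) (modelVectors Λ v j) := by
  simp_rw [dataCovariance, Matrix.mul_apply, modelVectors, inner_sum, sum_inner,
    inner_smul_left, inner_smul_right, Matrix.gram_apply, Matrix.transpose_apply, Finset.sum_mul]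
  refine Finset.sum_congr rfl fun l _ => Finset.sum_congr rfl fun k _ => ?_
  simp only [conj_trivial]
  ring

end PathInverse

/-! ### Deterministic estimates along the path. -/

section Recursion

variable {E : Type*} [NormedAddCommGroup E] [InnerProductSpace ℝ E] {n : ℕ}
  {Λ : Matrix (Fin n) (Fin n) ℝ} {v w : Fin n → E} {h σ : ℝ}

/-- The bound reproduces itself along the path: `σ * (1 - h) + h * σ = σ`. -/
lemma abs_inner_recursion_le (h0 : 0 ≤ h) (hΛ : ∀ i j, |Λ i j| ≤ h)
    (hv' : ∀ i j, i ≠ j → |inner ℝ (v i) (v j)| ≤ σ * (1 - h)) (hσ : 0 ≤ σ)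
    (w_zero : ∀ i : Fin n, (i : ℕ) = 0 → w i = v i)
    (w_succ : ∀ i j : Fin n, (i : ℕ) + 1 = j → w j = v j + Λ i j • w i)
    (i j : Fin n) (hij : i < j) : |inner ℝ (w i) (v j)| ≤ σ := by
  obtain ⟨m, hm⟩ := i
  induction m with
  | zero =>
    rw [w_zero _ rfl]
    nlinarith [hv' _ _ hij.ne]
  | succ m ih =>
    have hm' : m < n := by omega
    have ih' := ih hm' (lt_trans (by simp [Fin.lt_def]) hij)
    rw [w_succ ⟨m, hm'⟩ ⟨m + 1, hm⟩ rfl, inner_add_left, inner_smul_left, conj_trivial]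
    refine (abs_add_le _ _).trans ?_
    rw [abs_mul]
    have : |Λ ⟨m, hm'⟩ ⟨m + 1, hm⟩| * |inner ℝ (w ⟨m, hm'⟩) (v j)| ≤ h * σ := by
      gcongr
      exact hΛ _ _
    linarith [hv' _ _ hij.ne]

lemma norm_sq_recursion (hv : ∀ i, ‖v i‖ = 1)
    (w_succ : ∀ i j : Fin n, (i : ℕ) + 1 = j → w j = v j + Λ i j • w i)
    {i j : Fin n} (hij : (i : ℕ) + 1 = j) :
    ‖w j‖ ^ 2 = 1 + 2 * (Λ i j * inner ℝ (w i) (v j)) + Λ i j ^ 2 * ‖w i‖ ^ 2 := by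
  rw [w_succ i j hij, norm_add_sq_real, hv, inner_smul_right, real_inner_comm, norm_smul, mul_pow,
    Real.norm_eq_abs, sq_abs]
  ring

lemma abs_mul_inner_le {x l c : ℝ} (hl : |l| ≤ h) (hc : |c| ≤ x) : |l * c| ≤ h * x := by
  rw [abs_mul]
  exact mul_le_mul hl hc (abs_nonneg _) ((abs_nonneg _).trans hl)

lemma norm_sq_recursion_ge (h1 : h ≤ 1) (hΛ : ∀ i j, |Λ i j| ≤ h)
    (hv : ∀ i, ‖v i‖ = 1) (hσ : 0 ≤ σ)
    (w_zero : ∀ i : Fin n, (i : ℕ) = 0 → w i = v i)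
    (w_succ : ∀ i j : Fin n, (i : ℕ) + 1 = j → w j = v j + Λ i j • w i)
    (hc : ∀ i j : Fin n, i < j → |inner ℝ (w i) (v j)| ≤ σ) (j : Fin n) :
    1 - 2 * σ ≤ ‖w j‖ ^ 2 := by
  obtain ⟨m, hm⟩ := j
  cases m with
  | zero => rw [w_zero _ rfl, hv]; linarith
  | succ m =>
    have hm' : m < n := by omega
    rw [norm_sq_recursion hv w_succ (i := ⟨m, hm'⟩) rfl]
    have := abs_mul_inner_le (hΛ ⟨m, hm'⟩ ⟨m + 1, hm⟩) (hc ⟨m, hm'⟩ ⟨m + 1, hm⟩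
      (by simp [Fin.lt_def]))
    have h2 : h * σ ≤ σ := by nlinarith
    have h3 : 0 ≤ Λ ⟨m, hm'⟩ ⟨m + 1, hm⟩ ^ 2 * ‖w ⟨m, hm'⟩‖ ^ 2 := by positivity
    linarith [(abs_le.1 this).1]

/-- The value `(1 + 2σ) / (1 - h²)` is the fixed point of `A ↦ 1 + 2σ + h² A`, which dominates the
recursion for `‖w j‖²`. -/
lemma norm_sq_recursion_le (h0 : 0 ≤ h) (h1 : h ≤ 1) (hΛ : ∀ i j, |Λ i j| ≤ h)
    (hv : ∀ i, ‖v i‖ = 1) (hσ : 0 ≤ σ)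
    (w_zero : ∀ i : Fin n, (i : ℕ) = 0 → w i = v i)
    (w_succ : ∀ i j : Fin n, (i : ℕ) + 1 = j → w j = v j + Λ i j • w i)
    (hc : ∀ i j : Fin n, i < j → |inner ℝ (w i) (v j)| ≤ σ) (j : Fin n) :
    (1 - h ^ 2) * ‖w j‖ ^ 2 ≤ 1 + 2 * σ := by
  have hh : h ^ 2 ≤ 1 := by nlinarith
  obtain ⟨m, hm⟩ := j
  induction m with
  | zero => rw [w_zero _ rfl, hv]; nlinarith
  | succ m ih =>
    have hm' : m < n := by omega
    have ih' := ih hm'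
    rw [norm_sq_recursion hv w_succ (i := ⟨m, hm'⟩) rfl]
    have := abs_mul_inner_le (hΛ ⟨m, hm'⟩ ⟨m + 1, hm⟩) (hc ⟨m, hm'⟩ ⟨m + 1, hm⟩
      (by simp [Fin.lt_def]))
    have h2 : h * σ ≤ σ := by nlinarith
    have h3 : Λ ⟨m, hm'⟩ ⟨m + 1, hm⟩ ^ 2 * ((1 - h ^ 2) * ‖w ⟨m, hm'⟩‖ ^ 2) ≤
        h ^ 2 * (1 + 2 * σ) := by
      have := sq_le_sq.2 ((hΛ ⟨m, hm'⟩ ⟨m + 1, hm⟩).trans (le_abs_self h))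
      have h4 : 0 ≤ (1 - h ^ 2) * ‖w ⟨m, hm'⟩‖ ^ 2 :=
        mul_nonneg (by linarith) (by positivity)
      gcongr
    have h5 : (1 - h ^ 2) * (1 + 2 * (Λ ⟨m, hm'⟩ ⟨m + 1, hm⟩ *
        inner ℝ (w ⟨m, hm'⟩) (v ⟨m + 1, hm⟩))) ≤ (1 - h ^ 2) * (1 + 2 * σ) := by
      apply mul_le_mul_of_nonneg_left _ (by linarith)
      linarith [(abs_le.1 this).2]
    linarith

end Recursion

/-- The scalar inequality behind the comparison of neighbouring covariances; it needs
`h ≤ 1 / √2`. -/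
lemma abs_mul_le_of_sq_le_half {h l A σ : ℝ} (h0 : 0 ≤ h) (hh : h ^ 2 ≤ 1 / 2) (hl : |l| ≤ h)
    (hA : 0 ≤ A) (hA' : (1 - h ^ 2) * A ≤ 1 + 2 * σ) :
    |l| * A ≤ h * (1 + l ^ 2 * A) + 2 * h * σ := by
  -- Monotonicity of `t * (1 - h * t)` on `[0, h]`, by factoring the difference of its values at `h`
  -- and `|l|`.
  have h1 : |l| * (1 - h * |l|) ≤ h * (1 - h ^ 2) := by
    have : 0 ≤ (h - |l|) * (1 - h * (h + |l|)) := by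
      apply mul_nonneg (by linarith)
      nlinarith
    nlinarith
  have h2 := mul_le_mul_of_nonneg_right h1 hA
  have h3 := mul_le_mul_of_nonneg_left hA' h0
  rw [← sq_abs l]
  nlinarith

lemma locallyDominated_of_abs_inner_le {E : Type*} [NormedAddCommGroup E] [InnerProductSpace ℝ E]
    {n : ℕ} {Λ : Matrix (Fin n) (Fin n) ℝ} {v : Fin n → E} {h σ : ℝ} (h0 : 0 ≤ h)
    (hh : h ^ 2 ≤ 1 / 2) (hσ : 0 ≤ σ) (hσ' : σ ≤ 1 / 4)
    (hΛ0 : ∀ i j : Fin n, (i : ℕ) + 1 ≠ j → Λ i j = 0) (hΛ : ∀ i j, |Λ i j| ≤ h)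
    (hv : ∀ i, ‖v i‖ = 1) (hv' : ∀ i j, i ≠ j → |inner ℝ (v i) (v j)| ≤ σ * (1 - h)) :
    LocallyDominated (h + 12 * σ) (dataCovariance Λ (Matrix.gram ℝ v)) := by
  have h1 : h ≤ 1 := by nlinarith
  set w := modelVectors Λ v with hw
  have w_zero : ∀ i : Fin n, (i : ℕ) = 0 → w i = v i := fun i hi => modelVectors_zero hΛ0 v hi
  have w_succ : ∀ i j : Fin n, (i : ℕ) + 1 = j → w j = v j + Λ i j • w i :=
    fun i j hij => modelVectors_succ hΛ0 v hij
  have hc : ∀ i j : Fin n, i < j → |inner ℝ (w i) (v j)| ≤ σ :=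
    abs_inner_recursion_le h0 hΛ hv' hσ w_zero w_succ
  have hge := norm_sq_recursion_ge h1 hΛ hv hσ w_zero w_succ hc
  have hle := norm_sq_recursion_le h0 h1 hΛ hv hσ w_zero w_succ hc
  -- As `σ ≤ 1 / 4`, every squared norm is at least `1 / 2`; each additive `σ` thus costs `2σ` in
  -- the factor.
  have hσA : ∀ i, σ ≤ 2 * σ * ‖w i‖ ^ 2 := fun i => by
    have := mul_le_mul_of_nonneg_left (hge i) hσ
    nlinarith
  have hstep : ∀ i j k : Fin n, (i : ℕ) + 1 = j → k < j →
      |inner ℝ (w k) (w j)| ≤ |Λ i j| * |inner ℝ (w k) (w i)| + σ := by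
    intro i j k hij hkj
    rw [w_succ i j hij, inner_add_right, inner_smul_right, ← abs_mul, add_comm]
    exact (abs_add_le _ _).trans (by gcongr; exact hc k j hkj)
  have hleft : ∀ j i : Fin n, (j : ℕ) + 1 = i →
      |inner ℝ (w j) (w i)| ≤ (h + 10 * σ) * ‖w i‖ ^ 2 := by
    intro j i hji
    have hlt : j < i := by rw [Fin.lt_def]; omega
    have e1 := hstep j i j hji hlt
    rw [real_inner_self_eq_norm_sq, abs_of_nonneg (sq_nonneg ‖w j‖)] at e1
    have e2 := abs_mul_le_of_sq_le_half h0 hh (hΛ j i) (sq_nonneg ‖w j‖) (hle j)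
    have e3 := norm_sq_recursion hv w_succ hji
    have e4 := (abs_le.1 (abs_mul_inner_le (hΛ j i) (hc j i hlt))).1
    have e5 : h * (1 + Λ j i ^ 2 * ‖w j‖ ^ 2) ≤ h * (‖w i‖ ^ 2 + 2 * (h * σ)) := by
      apply mul_le_mul_of_nonneg_left _ h0
      linarith
    have e6 : h * σ ≤ σ := by nlinarith
    have e7 : h * (h * σ) ≤ σ := (mul_le_of_le_one_left (by positivity) h1).trans e6
    -- The errors `σ`, `2hσ` and `2h²σ` total at most `5σ`, hence `10σ` in the factor.
    linarith [hσA i]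
  intro i
  simp_rw [dataCovariance_gram_apply, ← hw, real_inner_self_eq_norm_sq]
  refine ⟨fun j hji => ?_, fun k hik => ?_, fun j k hji hik => ?_⟩
  · linarith [hleft j i hji, hσA i]
  · have e1 := hstep i k i hik (by rw [Fin.lt_def]; omega)
    rw [real_inner_self_eq_norm_sq, abs_of_nonneg (sq_nonneg ‖w i‖)] at e1
    have e2 := mul_le_mul_of_nonneg_right (hΛ i k) (sq_nonneg ‖w i‖)
    linarith [hσA i]
  -- One further step along the path adds one more `σ`, which raises `10σ` to `12σ`.
  · have e1 := hstep i k j hik (by rw [Fin.lt_def]; omega)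
    have e2 : |Λ i k| * |inner ℝ (w j) (w i)| ≤ |inner ℝ (w j) (w i)| :=
      mul_le_of_le_one_left (abs_nonneg _) ((hΛ i k).trans h1)
    linarith [hleft j i hji, hσA i]

/-! ### Asymptotics and choice of the sequences. -/

lemma tendsto_log_rpow_neg {b : ℝ} (hb : 0 < b) :
    Tendsto (fun n : ℕ => Real.log n ^ (-b)) atTop (𝓝 0) :=
  (tendsto_rpow_neg_atTop hb).comp (Real.tendsto_log_atTop.comp tendsto_natCast_atTop_atTop)

/-- The union bound over all pairs is dominated by the concentration rate when the dimension
grows faster than a power of the logarithm with exponent larger than one. -/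
lemma eventually_sq_mul_exp_le {a : ℝ} (ha : 1 < a) {d : ℕ → ℕ}
    (hd : ∃ C : ℝ, 0 < C ∧ ∀ᶠ n : ℕ in atTop, C * Real.log n ^ a ≤ d n) :
    ∀ᶠ n : ℕ in atTop,
      (n : ℝ) ^ 2 * (2 * Real.exp (-((Real.log n ^ (-((a - 1) / 4))) ^ 2 / 2)) ^ (d n - 1)) ≤
        2 / n := by
  obtain ⟨C, hC, hd⟩ := hd
  have hlog : Tendsto (fun n : ℕ => Real.log n) atTop atTop :=
    Real.tendsto_log_atTop.comp tendsto_natCast_atTop_atTop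
  have h1 := (tendsto_rpow_atTop (show 0 < (a - 1) / 2 by linarith)).comp hlog
  have h2 := (tendsto_rpow_atTop (show 0 < a by linarith)).comp hlog
  -- The threshold `2 / C` forces `d n ≥ 2`, so `d n - 1 ≥ d n / 2`; then `12 / C` makes the
  -- exponent at least `3 * log n`, and `n ^ 2 * 2 * n ^ (-3) = 2 / n`.
  filter_upwards [hd, h1.eventually_ge_atTop (12 / C), h2.eventually_ge_atTop (2 / C),
    hlog.eventually_gt_atTop 0, eventually_gt_atTop 0] with n hdn hn1 hn2 hL hn
  simp only [Function.comp_apply] at hn1 hn2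
  set L := Real.log n with hLdef
  have hn0 : (0 : ℝ) < n := by exact_mod_cast hn
  rw [div_le_iff₀ hC] at hn1 hn2
  have hd2 : (2 : ℝ) ≤ d n := by linarith
  have hd2' : 2 ≤ d n := by exact_mod_cast hd2
  have hcast : ((d n - 1 : ℕ) : ℝ) = d n - 1 := by
    rw [Nat.cast_sub (by omega), Nat.cast_one]
  have hsq : (L ^ (-((a - 1) / 4))) ^ 2 = L ^ (-((a - 1) / 2)) := by
    rw [← Real.rpow_natCast, ← Real.rpow_mul hL.le]
    congr 1
    push_cast
    ring
  have hpos : 0 < L ^ (-((a - 1) / 2)) := Real.rpow_pos_of_pos hL _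
  have hprod : L ^ (-((a - 1) / 2)) * L ^ a = L ^ ((a - 1) / 2) * L := by
    rw [← Real.rpow_add hL, ← Real.rpow_add_one hL.ne']
    congr 1
    ring
  have key : 3 * L ≤ (d n - 1 : ℝ) * (L ^ (-((a - 1) / 2)) / 2) := by
    calc 3 * L ≤ C * (L ^ ((a - 1) / 2) * L) / 4 := by nlinarith
      _ = C * L ^ a * L ^ (-((a - 1) / 2)) / 4 := by rw [← hprod]; ring
      _ ≤ d n * L ^ (-((a - 1) / 2)) / 4 := by gcongr
      _ ≤ _ := by nlinarith
  rw [hsq, ← Real.exp_nat_mul, hcast]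
  have hexp : Real.exp ((d n - 1 : ℝ) * -(L ^ (-((a - 1) / 2)) / 2)) ≤ ((n : ℝ) ^ 3)⁻¹ := by
    calc _ ≤ Real.exp (-(3 * L)) := Real.exp_le_exp.2 (by linarith)
      _ = ((n : ℝ) ^ 3)⁻¹ := by
        rw [Real.exp_neg, show (3 : ℝ) * L = (3 : ℕ) * L by norm_num, Real.exp_nat_mul,
          hLdef, Real.exp_log hn0]
  calc _ ≤ (n : ℝ) ^ 2 * (2 * ((n : ℝ) ^ 3)⁻¹) := by gcongr
    _ = 2 / n := by field_simp

theorem theorem4p1 (h : ℝ) (h_nonneg : 0 ≤ h) (h_lt : h < 1 / Real.sqrt 2)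
    (a : ℝ) (ha : 1 < a) (d : ℕ → ℕ)
    (hd : ∃ C : ℝ, 0 < C ∧ ∀ᶠ n : ℕ in atTop, C * Real.log n ^ a ≤ d n) :
    ∃ ζ χ δ₁ δ₂ : ℕ → ℝ,
      (∀ n, 0 ≤ ζ n) ∧
      (∃ ε : ℕ → ℝ, Tendsto ε atTop (𝓝 0) ∧ ∀ n, ζ n ≤ h + ε n) ∧
      (0 < h → ∃ c : ℝ, 0 < c ∧ ∀ᶠ n : ℕ in atTop, c * (n : ℝ) ^ (-2 : ℤ) ≤ χ n) ∧
      Tendsto δ₁ atTop (𝓝 0) ∧ Tendsto δ₂ atTop (𝓝 0) ∧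
      ∀ᶠ n : ℕ in atTop,
        (0 ≤ δ₁ n ∧ δ₁ n < 1 / 2) ∧ (0 ≤ δ₂ n ∧ δ₂ n < 1 / 2) ∧
        ∀ (S : Type*) [MeasurableSpace S] (P : Measure S) [IsProbabilityMeasure P]
          (Λ : S → Matrix (Fin n) (Fin n) ℝ)
          (v : Fin n → S → EuclideanSpace ℝ (Fin (d n))),
          IsRandomPathWeights P h Λ → IsRandomUnitVectors P v →
            1 - δ₁ n ≤ P.real {s | LocallyDominated (ζ n)
              (dataCovariance (Λ s) (Matrix.gram ℝ (fun i => v i s)))} ∧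
            1 - δ₂ n ≤ P.real {s | ∀ i j : Fin n, (i : ℕ) + 1 = j → χ n ≤ |Λ s i j|} := by
  have hh : h ^ 2 ≤ 1 / 2 := by
    calc h ^ 2 ≤ (1 / √2) ^ 2 := by gcongr
      _ = 1 / 2 := by rw [div_pow, one_pow, Real.sq_sqrt zero_le_two]
  have h1 : 0 < 1 - h := by nlinarith
  -- This `τ` tends to zero, yet `d * τ ^ 2` is at least of order `(log n) ^ ((a + 1) / 2)`, which
  -- outgrows `log n`.
  set τ : ℕ → ℝ := fun n => Real.log n ^ (-((a - 1) / 4)) with hτdef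
  have hτ : Tendsto τ atTop (𝓝 0) := tendsto_log_rpow_neg (by linarith)
  have hτ0 : ∀ n, 0 ≤ τ n := fun n => Real.rpow_nonneg (Real.log_natCast_nonneg n) _
  have hσ : Tendsto (fun n => τ n / (1 - h)) atTop (𝓝 0) := by
    simpa using hτ.div_const (1 - h)
  have hσ0 : ∀ n, 0 ≤ τ n / (1 - h) := fun n => div_nonneg (hτ0 n) h1.le
  have hδ₁ : Tendsto (fun n : ℕ => 2 / (n : ℝ)) atTop (𝓝 0) :=
    tendsto_const_div_atTop_nhds_zero_nat 2
  have hδ₂ : Tendsto (fun n : ℕ => 1 / (n : ℝ)) atTop (𝓝 0) :=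
    tendsto_const_div_atTop_nhds_zero_nat 1
  -- Dividing by `1 - h` pays for the accumulation of errors along the path. With threshold `h * n ^
  -- (-2)`, each of at most `n` edges fails with probability at most `n ^ (-2)`, whence `1 / n`.
  refine ⟨fun n => h + 12 * (τ n / (1 - h)), fun n => h * (n : ℝ) ^ (-2 : ℤ), fun n => 2 / n,
    fun n => 1 / n, fun n => by have := hσ0 n; positivity,
    ⟨fun n => 12 * (τ n / (1 - h)), by simpa using hσ.const_mul 12, fun n => le_rfl⟩,
    fun hpos => ⟨h, hpos, Eventually.of_forall fun n => le_rfl⟩, hδ₁, hδ₂, ?_⟩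
  filter_upwards [eventually_sq_mul_exp_le ha hd, hδ₁.eventually_lt_const one_half_pos,
    hδ₂.eventually_lt_const one_half_pos, eventually_gt_atTop 0,
    hσ.eventually_le_const (show (0 : ℝ) < 1 / 4 by norm_num),
    hτ.eventually_le_const (show (0 : ℝ) < 1 / 2 by norm_num)] with n hn hn1 hn2 hn0 hσn hτn
  have hn0' : (0 : ℝ) < n := by exact_mod_cast hn0
  refine ⟨⟨by positivity, hn1⟩, ⟨by positivity, hn2⟩, ?_⟩
  intro S _ P _ Λ v hΛ hv
  have hτ2 : τ n ^ 2 ≤ 1 / 2 := by nlinarith [hτ0 n]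
  constructor
  · refine one_sub_le_measureReal (by positivity)
      ((hv.measure_exists_abs_inner_le (hτ0 n) hτ2).trans (ENNReal.ofReal_le_ofReal hn)) ?_
    filter_upwards [ae_all_iff.2 hv.ae_norm_eq_one,
      ae_all_iff.2 fun i => ae_all_iff.2 fun j => hΛ.ae_abs_le h_nonneg i j] with s hs1 hs2 hs3
    refine locallyDominated_of_abs_inner_le h_nonneg hh (hσ0 n) hσn (hΛ.zero s) hs2 hs1 ?_
    intro i j hij
    rw [div_mul_cancel₀ _ h1.ne']
    by_contra! hlt
    exact hs3 ⟨i, j, hij, hlt.le⟩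
  · rcases h_nonneg.eq_or_lt with rfl | hpos
    -- For `h = 0` the threshold is `0` and the event is everything.
    · refine one_sub_le_measureReal (B := ∅) (by positivity) (by simp) (ae_of_all _ fun s _ => ?_)
      intro i j _
      simp
    · refine one_sub_le_measureReal (by positivity)
        ((hΛ.measure_exists_abs_lt_le hpos (h * (n : ℝ) ^ (-2 : ℤ))).trans
          (ENNReal.ofReal_le_ofReal (le_of_eq ?_))) (ae_of_all _ fun s hs i j hij => ?_)
      · rw [zpow_neg]
        field_simp
      · by_contra! hlt
        exact hs ⟨i, j, hij, hlt⟩
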